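/- Let $N$ be a natural number and let $L^\star$ be a real symmetric positive definite $N\times N$ matrix. For a real symmetric positive definite $N\times N$ matrix $L$ and $J\subseteq[N]=\{1,\dots,N\}$ put $$P_L(J)=\frac{\det(L_J)}{\sum_{A\subseteq[N]}\det(L_A)}=\frac{\det(L_J)}{\det(L+I)},$$ where $L_J=(L_{ij})_{i,j\in J}$ and $\det(L_\emptyset)=1$. Let $Z_1,Z_2,\dots$ be independent random subsets of $[N]$, defined on a common probability space, each with the law of the L-ensemble $\mathrm{DPP}(L^\star)$, that is, $\mathbb P(Z_i=J)=P_{L^\star}(J)$ for all $J\subseteq[N]$. For $n\ge 1$ let $$\hat\Phi_n(L)=\frac1n\sum_{i=1}^n\log P_L(Z_i),$$ and call $L$ a maximum likelihood estimate for the sample $Z_1,\dots,Z_n$ if it maximizes $\hat\Phi_n$ over all real symmetric positive definite $N\times N$ matrices. (For a given sample a maximizer need neither exist nor be unique.) For each $n\ge1$ let $\hat L_n$ be any maximum likelihood estimator, i.e. a matrix-valued function on the probability space which almost surely is a maximum likelihood estimate for $Z_1,\dots,Z_n$ whenever such an estimate exists, and is arbitrary otherwise. Then, almost surely, a maximum likelihood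 estimate for $Z_1,\dots,Z_n$ exists for all sufficiently large $n$, and $$\min_{D}\,\|\hat L_n-DL^\star D\|_F\longrightarrow 0\qquad\text{almost surely as } n\to\infty,$$ where $D$ ranges over all diagonal $N\times N$ matrices with diagonal entries in $\{1,-1\}$ and $\|\cdot\|_F$ is the Frobenius norm. -/

import Mathlib

open MeasureTheory ProbabilityTheory Filter Topology
open scoped Matrix.Norms.Frobenius

noncomputable section

namespace DPP

variable {N : ℕ}

/-- The principal minor `det (L_J)` of the rows and columns in `J` (equal to `1` for `J = ∅`). -/
def principalMinor (L : Matrix (Fin N) (Fin N) ℝ) (J : Finset (Fin N)) : ℝ :=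
  (L.submatrix (Subtype.val : J → Fin N) (Subtype.val : J → Fin N)).det

/-- The atomic probability `P_L(J)` of the L-ensemble `DPP(L)`: proportional to `det (L_J)`. -/
def lEnsembleProb (L : Matrix (Fin N) (Fin N) ℝ) (J : Finset (Fin N)) : ℝ :=
  principalMinor L J / ∑ A : Finset (Fin N), principalMinor L A

/-- The normalizing constant of an L-ensemble is `det (L + I)`. -/
theorem sum_principalMinor (L : Matrix (Fin N) (Fin N) ℝ) :
    ∑ A : Finset (Fin N), principalMinor L A = (L + 1).det := by
  have h := (Matrix.detRowAlternating (n := Fin N) (R := ℝ)).map_add_univ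
    (fun i => L i) (fun i => (1 : Matrix (Fin N) (Fin N) ℝ) i)
  exact (h.trans (Finset.sum_congr rfl fun s _ =>
    Matrix.det_piecewise_one_eq_submatrix_det L s)).symm

theorem lEnsembleProb_eq (L : Matrix (Fin N) (Fin N) ℝ) (J : Finset (Fin N)) :
    lEnsembleProb L J = principalMinor L J / (L + 1).det := by
  rw [lEnsembleProb, sum_principalMinor]

/-- The scaled log-likelihood `(1/n) ∑ᵢ log P_L(zᵢ)` of a sample `z₁, …, zₙ` of subsets. -/
def logLikelihood {n : ℕ} (z : Fin n → Finset (Fin N)) (L : Matrix (Fin N) (Fin N) ℝ) : ℝ :=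
  (1 / (n : ℝ)) * ∑ i, Real.log (lEnsembleProb L (z i))

/-- `L` is a maximum likelihood estimate for the sample `z`: a global maximizer of the
log-likelihood over the positive definite (real symmetric) matrices. -/
def IsMLE {n : ℕ} (z : Fin n → Finset (Fin N)) (L : Matrix (Fin N) (Fin N) ℝ) : Prop :=
  L.PosDef ∧ ∀ M : Matrix (Fin N) (Fin N) ℝ, M.PosDef → logLikelihood z M ≤ logLikelihood z L

/-- The diagonal matrix with diagonal entries `ε i ∈ {1, -1}`. -/
def signMatrix (ε : Fin N → ℤˣ) : Matrix (Fin N) (Fin N) ℝ :=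
  Matrix.diagonal fun i => ((ε i : ℤ) : ℝ)

/-- `ℓ(A, B) = min_D ‖A - D B D‖_F`, the Frobenius distance of `A` to the orbit of `B` under
conjugation by diagonal `±1` matrices. -/
def signDist (A B : Matrix (Fin N) (Fin N) ℝ) : ℝ :=
  Finset.univ.inf' Finset.univ_nonempty fun ε : Fin N → ℤˣ =>
    ‖A - signMatrix ε * B * signMatrix ε‖

end DPP

end

/-! The log-likelihood of a sample is linear in its empirical frequencies, which converge almost
surely to the true atoms, all positive. Once the weights are bounded below, a likelihood bound keeps
every atom above some `δ > 0`, and such kernels form a compact set of positive definite matrices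
(`isCompact_atomsGE`). Hence maximizers exist, and every limit point of them has limiting likelihood
at least that of `Lstar`; Gibbs' inequality then gives it the law of `Lstar`.

Identifiability finishes the proof: the law fixes all principal minors, and these fix the kernel up
to signs (`exists_sign_of_det_submatrix_eq`). That is an induction on the size, applied both to the
trailing block and to the Schur complement of the corner; `exists_sign_of_schur` reconciles the two
sign patterns. -/

/-! ### Principal minors determine a symmetric matrix up to signs -/

/-- The determinant of a bordered matrix through the Schur complement of its corner entry. -/
theorem Matrix.det_eq_corner_mul_det_schur {m : ℕ} (M : Matrix (Fin (m + 1)) (Fin (m + 1)) ℝ)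
    (h : M 0 0 ≠ 0) :
    M.det = M 0 0 *
      (Matrix.of fun i j : Fin m => M i.succ j.succ - M i.succ 0 * M 0 j.succ / M 0 0).det := by
  set S : Matrix (Fin (m + 1)) (Fin (m + 1)) ℝ :=
    Matrix.of (Fin.cons (M 0) fun i j => M i.succ j - M i.succ 0 / M 0 0 * M 0 j) with hS
  have h1 : M.det = S.det := by
    refine Matrix.det_eq_of_forall_row_eq_smul_add_const
      (Fin.cons 0 fun i => M i.succ 0 / M 0 0) 0 (by simp) ?_
    intro i j
    refine Fin.cases ?_ (fun i => ?_) i <;> simp [S]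
  rw [h1, Matrix.det_succ_column_zero, Fin.sum_univ_succ, Finset.sum_eq_zero, add_zero]
  · simp only [Fin.val_zero, pow_zero, one_mul]
    congr 2
    ext i j
    simp [S]
    ring
  · intro i _
    have : S i.succ 0 = 0 := by simp [S, h]
    rw [this]; ring

namespace DPP

/-- If symmetric bordered matrices share the block `A`, have borders `a` and `b` that agree up to
signs, and have signature similar Schur complements, then they are signature similar. -/
theorem exists_sign_of_schur {n : ℕ} (A : Matrix (Fin n) (Fin n) ℝ) (hA : ∀ i j, A i j = A j i)
    (a b : Fin n → ℝ) (α : ℝ) (hα : α ≠ 0) (e D : Fin n → ℤˣ)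
    (he : ∀ i, a i = ((e i : ℤ) : ℝ) * b i)
    (hD : ∀ i j, A i j - a i * a j / α =
      ((D i : ℤ) : ℝ) * ((D j : ℤ) : ℝ) * (A i j - b i * b j / α)) :
    ∃ d : Fin n → ℤˣ, (∀ i j, A i j = ((d i : ℤ) : ℝ) * A i j * ((d j : ℤ) : ℝ)) ∧
      ∀ i, a i = ((d i : ℤ) : ℝ) * b i := by
  classical
  have hsq : ∀ u : ℤˣ, ((u : ℤ) : ℝ) * ((u : ℤ) : ℝ) = 1 := fun u => by
    rcases Int.units_eq_one_or u with h | h <;> simp [h]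
  have same : ∀ i j, D i = D j → b i ≠ 0 → b j ≠ 0 → e i = e j := by
    intro i j hij hi hj
    have h := hD i j
    rw [hij, hsq, one_mul, he i, he j] at h
    have h2 : ((e i : ℤ) : ℝ) * b i * (((e j : ℤ) : ℝ) * b j) = b i * b j := by
      exact (div_left_inj' hα).mp (sub_right_injective h)
    have h4 : b i * b j ≠ 0 := mul_ne_zero hi hj
    rcases Int.units_eq_one_or (e i) with h' | h' <;>
    rcases Int.units_eq_one_or (e j) with h'' | h'' <;> simp only [h', h''] at h2 ⊢ <;>
      (exfalso; apply h4; push_cast at h2; linarith)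
  -- If both `D` and `e` changed sign across the edge, the border terms would cancel in `hD` and
  -- leave `A i j = 0`.
  have edge : ∀ i j, A i j ≠ 0 → b i ≠ 0 → b j ≠ 0 → e i = e j := by
    intro i j hij hi hj
    by_cases hd : D i = D j
    · exact same i j hd hi hj
    have h := hD i j
    have h4 : b i * b j ≠ 0 := mul_ne_zero hi hj
    have hdd : ((D i : ℤ) : ℝ) * ((D j : ℤ) : ℝ) = -1 := by
      rcases Int.units_eq_one_or (D i) with h' | h' <;>
      rcases Int.units_eq_one_or (D j) with h'' | h'' <;> simp_all
    rw [hdd, he i, he j] at h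
    by_contra hne
    have hee : ((e i : ℤ) : ℝ) * ((e j : ℤ) : ℝ) = -1 := by
      rcases Int.units_eq_one_or (e i) with h' | h' <;>
      rcases Int.units_eq_one_or (e j) with h'' | h'' <;> simp_all
    apply hij
    have : ((e i : ℤ) : ℝ) * b i * (((e j : ℤ) : ℝ) * b j) = - (b i * b j) := by
      linear_combination (b i * b j) * hee
    rw [this] at h
    have h5 : -(b i * b j) / α = -(b i * b j / α) := by ring
    rw [h5] at h
    linarith
  have edge' : ∀ i j, A i j ≠ 0 → (b i = 0 ∨ b j = 0) → D i = D j := by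
    intro i j hij hb
    have h := hD i j
    have h1 : a i * a j = 0 := by rw [he i, he j]; rcases hb with h | h <;> simp [h]
    have h2 : b i * b j = 0 := by rcases hb with h | h <;> simp [h]
    rw [h1, h2] at h
    by_contra hne
    have hdd : ((D i : ℤ) : ℝ) * ((D j : ℤ) : ℝ) = -1 := by
      rcases Int.units_eq_one_or (D i) with h' | h' <;>
      rcases Int.units_eq_one_or (D j) with h'' | h'' <;> simp_all
    rw [hdd] at h
    apply hij
    simp at h
    linarith
  -- Connectivity in the graph of nonzero entries of `A`. A suitable `d` exists once `e` is constant
  -- on the vertices of each component where `b` is nonzero.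
  let R : Fin n → Fin n → Prop := Relation.ReflTransGen fun i j => A i j ≠ 0
  have : Std.Symm fun i j => A i j ≠ 0 := ⟨fun x y hxy => by rwa [hA y x]⟩
  have Rsymm : ∀ i j, R i j → R j i := fun i j h => Relation.ReflTransGen.stdSymm.symm i j h
  -- Here `k` is the last vertex on the path with `b k ≠ 0`. Since `D` does not change along a
  -- stretch where `b` vanishes, `same` carries `e` across it.
  have walk : ∀ i v, b i ≠ 0 → R i v →
      ∃ k, b k ≠ 0 ∧ e k = e i ∧ D v = D k ∧ (b v ≠ 0 → v = k) := by
    intro i v hi h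
    induction h with
    | refl => exact ⟨i, hi, rfl, rfl, fun _ => rfl⟩
    | @tail v w _ hvw ih =>
      obtain ⟨k, hk, hek, hDk, hvk⟩ := ih
      by_cases hw : b w = 0
      · exact ⟨k, hk, hek, (edge' v w hvw (Or.inr hw)).symm.trans hDk, fun h => absurd hw h⟩
      · refine ⟨w, hw, ?_, rfl, fun _ => rfl⟩
        by_cases hv : b v = 0
        · rw [← hek]
          exact same w k ((edge' v w hvw (Or.inl hv)).symm.trans hDk) hw hk
        · rw [← hek, ← hvk hv]
          exact (edge v w hvw hv hw).symm
  have const : ∀ i j, b i ≠ 0 → b j ≠ 0 → R i j → e i = e j := by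
    intro i j hi hj h
    obtain ⟨k, _, hek, _, hjk⟩ := walk i j hi h
    rw [hjk hj, hek]
  -- On components where `b` vanishes identically any constant sign works; 1 is chosen.
  let d : Fin n → ℤˣ := fun v =>
    if h : ∃ i, b i ≠ 0 ∧ R v i then e h.choose else 1
  have hd : ∀ v i, b i ≠ 0 → R v i → d v = e i := by
    intro v i hi hvi
    have h : ∃ i, b i ≠ 0 ∧ R v i := ⟨i, hi, hvi⟩
    have : d v = e h.choose := dif_pos h
    rw [this]
    exact const _ _ h.choose_spec.1 hi ((Rsymm _ _ h.choose_spec.2).trans hvi)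
  refine ⟨d, fun i j => ?_, fun i => ?_⟩
  · by_cases hij : A i j = 0
    · simp [hij]
    have hdij : d i = d j := by
      have hR : R i j := Relation.ReflTransGen.single hij
      by_cases h : ∃ k, b k ≠ 0 ∧ R i k
      · obtain ⟨k, hk, hik⟩ := h
        rw [hd i k hk hik, hd j k hk ((Rsymm _ _ hR).trans hik)]
      · have h' : ¬ ∃ k, b k ≠ 0 ∧ R j k := fun ⟨k, hk, hjk⟩ => h ⟨k, hk, hR.trans hjk⟩
        simp only [d, dif_neg h, dif_neg h']
    rw [hdij]
    linear_combination (-(A i j)) * hsq (d j)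
  · by_cases hi : b i = 0
    · rw [he i]; simp [hi]
    · rw [hd i i hi Relation.ReflTransGen.refl, he i]

/-- Real symmetric matrices with equal, nonzero principal minors are conjugate by a diagonal sign
matrix. -/
theorem exists_sign_of_det_submatrix_eq : ∀ {n : ℕ} (A B : Matrix (Fin n) (Fin n) ℝ),
    (∀ i j, A i j = A j i) → (∀ i j, B i j = B j i) →
    (∀ (m : ℕ) (f : Fin m → Fin n), Function.Injective f →
      (A.submatrix f f).det = (B.submatrix f f).det ∧ (B.submatrix f f).det ≠ 0) →
    ∃ d : Fin n → ℤˣ, ∀ i j, A i j = ((d i : ℤ) : ℝ) * B i j * ((d j : ℤ) : ℝ)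
  | 0, _, _, _, _, _ => ⟨fun _ => 1, fun i => i.elim0⟩
  | n + 1, A, B, hA, hB, h => by
    have h00 : A 0 0 = B 0 0 ∧ B 0 0 ≠ 0 := by
      simpa [Matrix.det_fin_one] using h 1 (fun _ => 0) (Function.injective_of_subsingleton _)
    obtain ⟨h00, hα⟩ := h00
    have hdiag : ∀ i, A i i = B i i := fun i => by
      simpa [Matrix.det_fin_one] using (h 1 (fun _ => i) (Function.injective_of_subsingleton _)).1
    have hsq : ∀ u : ℤˣ, ((u : ℤ) : ℝ) * ((u : ℤ) : ℝ) = 1 := fun u => by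
      rcases Int.units_eq_one_or u with h | h <;> simp [h]
    obtain ⟨d₁, hd₁⟩ := exists_sign_of_det_submatrix_eq
      (A.submatrix Fin.succ Fin.succ) (B.submatrix Fin.succ Fin.succ)
      (fun i j => hA _ _) (fun i j => hB _ _)
      (fun m f hf => by
        simpa using h m (Fin.succ ∘ f) ((Fin.succ_injective n).comp hf))
    -- Minors of the Schur complement are the minors containing index 0, divided by the common
    -- corner entry.
    obtain ⟨d₂, hd₂⟩ := exists_sign_of_det_submatrix_eq
      (Matrix.of fun i j : Fin n => A i.succ j.succ - A i.succ 0 * A 0 j.succ / A 0 0)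
      (Matrix.of fun i j : Fin n => B i.succ j.succ - B i.succ 0 * B 0 j.succ / B 0 0)
      (fun i j => by
        simp only [Matrix.of_apply]
        rw [hA i.succ j.succ, hA i.succ 0, hA 0 j.succ]; ring)
      (fun i j => by
        simp only [Matrix.of_apply]
        rw [hB i.succ j.succ, hB i.succ 0, hB 0 j.succ]; ring)
      (fun m f hf => by
        have hg : Function.Injective (Fin.cons 0 (Fin.succ ∘ f) : Fin (m + 1) → Fin (n + 1)) := by
          rw [Fin.cons_injective_iff]
          exact ⟨by simp [Fin.succ_ne_zero], (Fin.succ_injective n).comp hf⟩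
        have hs : ∀ M : Matrix (Fin (n + 1)) (Fin (n + 1)) ℝ, M 0 0 ≠ 0 →
            (M.submatrix (Fin.cons 0 (Fin.succ ∘ f) : Fin (m + 1) → Fin (n + 1))
              (Fin.cons 0 (Fin.succ ∘ f))).det = M 0 0 *
            ((Matrix.of fun i j : Fin n =>
              M i.succ j.succ - M i.succ 0 * M 0 j.succ / M 0 0).submatrix f f).det :=
          fun M hM => by
            rw [Matrix.det_eq_corner_mul_det_schur _ (by simpa using hM)]
            rfl
        obtain ⟨h1, h2⟩ := h _ _ hg
        rw [hs A (h00 ▸ hα), hs B hα, h00] at h1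
        rw [hs B hα] at h2
        refine ⟨?_, right_ne_zero_of_mul h2⟩
        have := mul_left_cancel₀ hα h1
        rwa [h00])
    have hborder : ∀ i : Fin n, ∃ e : ℤˣ,
        A i.succ 0 = ((e : ℤ) : ℝ) * (((d₁ i : ℤ) : ℝ) * B i.succ 0) := by
      intro i
      have h2 := (h 2 ![0, i.succ] (by
        intro x y hxy
        fin_cases x <;> fin_cases y <;> simp_all [Fin.succ_ne_zero, eq_comm])).1
      simp only [Matrix.det_fin_two, Matrix.submatrix_apply, Matrix.cons_val_zero,
        Matrix.cons_val_one] at h2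
      rw [hA 0 i.succ, hB 0 i.succ, hdiag, hdiag] at h2
      have h3 : (A i.succ 0) ^ 2 = (((d₁ i : ℤ) : ℝ) * B i.succ 0) ^ 2 := by
        linear_combination -h2 - (B i.succ 0) ^ 2 * hsq (d₁ i)
      rcases sq_eq_sq_iff_eq_or_eq_neg.mp h3 with h | h
      · exact ⟨1, by simpa using h⟩
      · exact ⟨-1, by simpa using h⟩
    choose e he using hborder
    -- Conjugating `B` by `d₁` makes the trailing blocks equal; the Schur complements then differ by
    -- the signs `d₂ * d₁`.
    obtain ⟨d, hd, hab⟩ := exists_sign_of_schur (A.submatrix Fin.succ Fin.succ)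
      (fun i j => hA _ _) (fun i => A i.succ 0) (fun i => ((d₁ i : ℤ) : ℝ) * B i.succ 0) (B 0 0) hα
      e (fun i => d₂ i * d₁ i) he (fun i j => by
        have h2 := hd₂ i j
        have h1 := hd₁ i j
        simp only [Matrix.of_apply, Matrix.submatrix_apply] at h1 h2 ⊢
        rw [h00, hA 0 j.succ, hB 0 j.succ] at h2
        rw [h2, h1]
        push_cast
        linear_combination (-((d₂ i : ℤ) : ℝ) * ((d₂ j : ℤ) : ℝ) *
            (B i.succ j.succ - B i.succ 0 * B j.succ 0 / B 0 0)) * 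
          (((d₁ j : ℤ) : ℝ) * ((d₁ j : ℤ) : ℝ) * hsq (d₁ i) + hsq (d₁ j)))
    refine ⟨Fin.cons 1 fun i => d i * d₁ i, fun i j => ?_⟩
    refine Fin.cases ?_ (fun i => ?_) i <;> refine Fin.cases ?_ (fun j => ?_) j
    · simpa using h00
    · have := hab j
      simp only [Fin.cons_zero, Fin.cons_succ]
      rw [hA, hB, this]
      push_cast
      ring
    · have := hab i
      simp only [Fin.cons_zero, Fin.cons_succ]
      rw [this]
      push_cast
      ring
    · have h1 := hd i j
      have h2 := hd₁ i j
      simp only [Matrix.submatrix_apply] at h1 h2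
      simp only [Fin.cons_succ]
      rw [h1, h2]
      push_cast
      ring

end DPP

namespace DPP

/-! ### Atoms of an L-ensemble and identifiability -/

variable {N : ℕ}

theorem signMatrix_mul_mul_apply (ε : Fin N → ℤˣ) (B : Matrix (Fin N) (Fin N) ℝ) (i j : Fin N) :
    (signMatrix ε * B * signMatrix ε) i j = ((ε i : ℤ) : ℝ) * B i j * ((ε j : ℤ) : ℝ) := by
  simp [signMatrix, Matrix.mul_diagonal, Matrix.diagonal_mul]

theorem det_submatrix_eq_principalMinor {m : ℕ} (L : Matrix (Fin N) (Fin N) ℝ) (f : Fin m → Fin N)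
    (hf : Function.Injective f) :
    (L.submatrix f f).det = principalMinor L (Finset.univ.map ⟨f, hf⟩) := by
  let e : Fin m ≃ (Finset.univ.map ⟨f, hf⟩ : Finset (Fin N)) :=
    Equiv.ofBijective (fun i => ⟨f i, by simp⟩)
      ⟨fun i j h => hf (by simpa using h), fun ⟨x, hx⟩ => by
        obtain ⟨i, hi⟩ := by simpa using hx
        exact ⟨i, by simp [hi]⟩⟩
  rw [principalMinor, ← Matrix.det_submatrix_equiv_self e, Matrix.submatrix_submatrix]
  rfl

theorem principalMinor_empty (L : Matrix (Fin N) (Fin N) ℝ) : principalMinor L ∅ = 1 := by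
  simp [principalMinor]

theorem principalMinor_singleton (L : Matrix (Fin N) (Fin N) ℝ) (i : Fin N) :
    principalMinor L {i} = L i i := by
  have := det_submatrix_eq_principalMinor L (fun _ : Fin 1 => i)
    (Function.injective_of_subsingleton _)
  simpa [Matrix.det_fin_one] using this.symm

theorem principalMinor_univ (L : Matrix (Fin N) (Fin N) ℝ) :
    principalMinor L Finset.univ = L.det := by
  have := det_submatrix_eq_principalMinor L id Function.injective_id
  rw [Matrix.submatrix_id_id] at this
  rw [this]
  congr 1
  ext
  simp

theorem principalMinor_nonneg {L : Matrix (Fin N) (Fin N) ℝ} (hL : L.PosSemidef)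
    (J : Finset (Fin N)) : 0 ≤ principalMinor L J :=
  (hL.submatrix _).det_nonneg

theorem principalMinor_pos {L : Matrix (Fin N) (Fin N) ℝ} (hL : L.PosDef)
    (J : Finset (Fin N)) : 0 < principalMinor L J :=
  (hL.submatrix Subtype.val_injective).det_pos

theorem sum_principalMinor_pos {L : Matrix (Fin N) (Fin N) ℝ} (hL : L.PosSemidef) :
    0 < ∑ A, principalMinor L A :=
  Finset.sum_pos' (fun A _ => principalMinor_nonneg hL A)
    ⟨∅, Finset.mem_univ _, by rw [principalMinor_empty]; exact one_pos⟩

theorem lEnsembleProb_pos {L : Matrix (Fin N) (Fin N) ℝ} (hL : L.PosDef) (J : Finset (Fin N)) :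
    0 < lEnsembleProb L J :=
  div_pos (principalMinor_pos hL J) (sum_principalMinor_pos hL.posSemidef)

theorem lEnsembleProb_le_one {L : Matrix (Fin N) (Fin N) ℝ} (hL : L.PosSemidef)
    (J : Finset (Fin N)) : lEnsembleProb L J ≤ 1 :=
  div_le_one_of_le₀ (Finset.single_le_sum (fun A _ => principalMinor_nonneg hL A)
    (Finset.mem_univ J)) (sum_principalMinor_pos hL).le

theorem sum_lEnsembleProb {L : Matrix (Fin N) (Fin N) ℝ} (hL : L.PosSemidef) :
    ∑ J, lEnsembleProb L J = 1 := by
  simp only [lEnsembleProb]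
  rw [← Finset.sum_div, div_self (sum_principalMinor_pos hL).ne']

/-- The law of an L-ensemble determines its kernel up to signature similarity. -/
theorem signDist_eq_zero_of_lEnsembleProb_eq {L M : Matrix (Fin N) (Fin N) ℝ} (hL : L.PosDef)
    (hM : M.PosDef) (h : ∀ J, lEnsembleProb L J = lEnsembleProb M J) : signDist L M = 0 := by
  have hsum : ∑ A, principalMinor L A = ∑ A, principalMinor M A := by
    -- The empty minor is 1, so this atom reveals the normalizing constant.
    have := h ∅
    simp only [lEnsembleProb, principalMinor_empty, one_div] at this
    exact inv_injective this
  have hminor : ∀ J, principalMinor L J = principalMinor M J := fun J => by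
    have := h J
    rw [lEnsembleProb, lEnsembleProb, hsum] at this
    exact (div_left_inj' (sum_principalMinor_pos hM.posSemidef).ne').mp this
  obtain ⟨d, hd⟩ := exists_sign_of_det_submatrix_eq L M
    (fun i j => by simpa using hL.isHermitian.apply j i)
    (fun i j => by simpa using hM.isHermitian.apply j i)
    (fun m f hf => by
      rw [det_submatrix_eq_principalMinor L f hf, det_submatrix_eq_principalMinor M f hf]
      exact ⟨hminor _, (principalMinor_pos hM _).ne'⟩)
  refine le_antisymm ?_ (Finset.le_inf' _ _ fun _ _ => norm_nonneg _)
  refine (Finset.inf'_le _ (Finset.mem_univ d)).trans_eq ?_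
  rw [norm_eq_zero, sub_eq_zero]
  ext i j
  rw [signMatrix_mul_mul_apply, hd]

theorem continuous_signDist (M : Matrix (Fin N) (Fin N) ℝ) :
    Continuous fun L => signDist L M := by
  unfold signDist
  exact Continuous.finset_inf'_apply _ fun ε _ => (continuous_id.sub continuous_const).norm

theorem continuous_principalMinor (J : Finset (Fin N)) :
    Continuous fun L : Matrix (Fin N) (Fin N) ℝ => principalMinor L J :=
  (continuous_id.matrix_submatrix _ _).matrix_det

theorem isClosed_posSemidef : IsClosed {L : Matrix (Fin N) (Fin N) ℝ | L.PosSemidef} := by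
  simp only [Matrix.posSemidef_iff_dotProduct_mulVec, Set.ofPred_and, Set.ofPred_forall]
  refine IsClosed.inter ?_ (isClosed_iInter fun x => ?_)
  · exact isClosed_eq continuous_id.matrix_conjTranspose continuous_id
  · exact isClosed_le continuous_const
      (continuous_const.dotProduct (continuous_id.matrix_mulVec continuous_const))

/-! ### Compactness of the kernels with atoms bounded below -/

/-- The kernels of L-ensembles all of whose atoms have probability at least `δ`. -/
def atomsGE (N : ℕ) (δ : ℝ) : Set (Matrix (Fin N) (Fin N) ℝ) :=
  {L | L.PosSemidef ∧ ∀ J, δ * ∑ A, principalMinor L A ≤ principalMinor L J}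

theorem mem_atomsGE_iff {δ : ℝ} {L : Matrix (Fin N) (Fin N) ℝ} :
    L ∈ atomsGE N δ ↔ L.PosSemidef ∧ ∀ J, δ ≤ lEnsembleProb L J :=
  and_congr_right fun hL => forall_congr' fun _ => (le_div_iff₀ (sum_principalMinor_pos hL)).symm

theorem posDef_of_mem_atomsGE {δ : ℝ} (hδ : 0 < δ) {L : Matrix (Fin N) (Fin N) ℝ}
    (hL : L ∈ atomsGE N δ) : L.PosDef := by
  rw [hL.1.posDef_iff_isUnit, Matrix.isUnit_iff_isUnit_det, isUnit_iff_ne_zero]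
  have h := hL.2 Finset.univ
  rw [principalMinor_univ] at h
  exact ((mul_pos hδ (sum_principalMinor_pos hL.1)).trans_le h).ne'

/-- The empty atom bounds the normalizing constant, hence the diagonal, by `δ⁻¹`; nonnegative 2×2
minors then bound the other entries. -/
theorem isCompact_atomsGE {δ : ℝ} (hδ : 0 < δ) : IsCompact (atomsGE N δ) := by
  have hbox : IsCompact (Set.univ.pi fun _ : Fin N => Set.univ.pi fun _ : Fin N =>
      Set.Icc (-δ⁻¹) δ⁻¹ : Set (Fin N → Fin N → ℝ)) :=
    isCompact_univ_pi fun _ => isCompact_univ_pi fun _ => isCompact_Icc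
  refine IsCompact.of_isClosed_subset (X := Matrix (Fin N) (Fin N) ℝ) hbox ?_ ?_
  · simp only [atomsGE, Set.ofPred_and, Set.ofPred_forall]
    exact isClosed_posSemidef.inter (isClosed_iInter fun J => isClosed_le
      (continuous_const.mul (continuous_finsetSum _ fun A _ => continuous_principalMinor A))
      (continuous_principalMinor J))
  · intro (L : Matrix (Fin N) (Fin N) ℝ) (hL : L ∈ atomsGE N δ) i _ j _
    have hdiag : ∀ i, 0 ≤ L i i ∧ L i i ≤ δ⁻¹ := fun i => by
      rw [← principalMinor_singleton L i]
      refine ⟨principalMinor_nonneg hL.1 _, ?_⟩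
      have h := hL.2 ∅
      rw [principalMinor_empty, mul_comm, ← le_div_iff₀ hδ, one_div] at h
      exact (Finset.single_le_sum (fun A _ => principalMinor_nonneg hL.1 A)
        (Finset.mem_univ _)).trans h
    have h2 := (hL.1.submatrix ![i, j]).det_nonneg
    simp only [Matrix.det_fin_two, Matrix.submatrix_apply, Matrix.cons_val_zero,
      Matrix.cons_val_one] at h2
    have hsymm : L j i = L i j := by simpa using hL.1.isHermitian.apply i j
    have h3 : L i i * L j j ≤ δ⁻¹ * δ⁻¹ :=
      mul_le_mul (hdiag i).2 (hdiag j).2 (hdiag j).1 (inv_pos.2 hδ).le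
    rw [hsymm] at h2
    exact abs_le.mp (abs_le_of_sq_le_sq (by nlinarith) (inv_pos.2 hδ).le)

theorem continuousOn_log_lEnsembleProb {δ : ℝ} (hδ : 0 < δ) (J : Finset (Fin N)) :
    ContinuousOn (fun L => Real.log (lEnsembleProb L J)) (atomsGE N δ) := by
  refine ContinuousOn.log (ContinuousOn.div (continuous_principalMinor J).continuousOn
    (continuous_finsetSum _ fun A _ => continuous_principalMinor A).continuousOn
    fun L hL => (sum_principalMinor_pos hL.1).ne')
    fun L hL => (lEnsembleProb_pos (posDef_of_mem_atomsGE hδ hL) J).ne'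

/-! ### Existence and convergence of maximizers -/

/-- The log-likelihood of the L-ensemble with kernel `L` under weights `p` on the subsets. -/
noncomputable def weightedLogLikelihood (p : Finset (Fin N) → ℝ)
    (L : Matrix (Fin N) (Fin N) ℝ) : ℝ :=
  ∑ J, p J * Real.log (lEnsembleProb L J)

/-- A lower bound on the weighted log-likelihood bounds all atoms from below. -/
theorem mem_atomsGE_of_le_weightedLogLikelihood {p : Finset (Fin N) → ℝ} {η C : ℝ} (hη : 0 < η)
    (hp : ∀ J, η ≤ p J) {L : Matrix (Fin N) (Fin N) ℝ} (hL : L.PosDef)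
    (h : -C ≤ weightedLogLikelihood p L) : L ∈ atomsGE N (Real.exp (-C / η)) := by
  refine mem_atomsGE_iff.2 ⟨hL.posSemidef, fun J => ?_⟩
  have hlog : ∀ A, Real.log (lEnsembleProb L A) ≤ 0 := fun A =>
    Real.log_nonpos (lEnsembleProb_pos hL A).le (lEnsembleProb_le_one hL.posSemidef A)
  rw [← Real.le_log_iff_exp_le (lEnsembleProb_pos hL J), div_le_iff₀ hη]
  have h1 : weightedLogLikelihood p L ≤ p J * Real.log (lEnsembleProb L J) := by
    have := Finset.single_le_sum (f := fun A => -(p A * Real.log (lEnsembleProb L A)))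
      (fun A _ => neg_nonneg.2 (mul_nonpos_of_nonneg_of_nonpos (hη.le.trans (hp A)) (hlog A)))
      (Finset.mem_univ J)
    rw [Finset.sum_neg_distrib] at this
    exact neg_le_neg_iff.1 this
  have h2 := mul_le_mul_of_nonpos_right (hp J) (hlog J)
  linarith

/-- Every kernel at least as likely as the identity lies in one compact set `atomsGE`, so a
maximizer there is global. -/
theorem exists_isMax_weightedLogLikelihood {p : Finset (Fin N) → ℝ} (hp : ∀ J, 0 < p J) :
    ∃ L : Matrix (Fin N) (Fin N) ℝ, L.PosDef ∧ ∀ M : Matrix (Fin N) (Fin N) ℝ, M.PosDef →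
      weightedLogLikelihood p M ≤ weightedLogLikelihood p L := by
  obtain ⟨J₀, hJ₀⟩ := Finite.exists_min p
  have hone : (1 : Matrix (Fin N) (Fin N) ℝ).PosDef := Matrix.PosDef.one
  set C := -weightedLogLikelihood p (1 : Matrix (Fin N) (Fin N) ℝ) with hC
  have hmem : ∀ M : Matrix (Fin N) (Fin N) ℝ, M.PosDef →
      weightedLogLikelihood p 1 ≤ weightedLogLikelihood p M →
      M ∈ atomsGE N (Real.exp (-C / p J₀)) := fun M hM h =>
    mem_atomsGE_of_le_weightedLogLikelihood (hp J₀) hJ₀ hM (by rwa [hC, neg_neg])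
  obtain ⟨L, hL, hmax⟩ := (isCompact_atomsGE (N := N) (Real.exp_pos _)).exists_isMaxOn
    ⟨1, hmem 1 hone le_rfl⟩ (f := weightedLogLikelihood p)
    (continuousOn_finsetSum _ fun J _ =>
      continuousOn_const.mul (continuousOn_log_lEnsembleProb (Real.exp_pos _) J))
  refine ⟨L, posDef_of_mem_atomsGE (Real.exp_pos _) hL, fun M hM => ?_⟩
  rcases le_total (weightedLogLikelihood p 1) (weightedLogLikelihood p M) with h | h
  · exact hmax (hmem M hM h)
  · exact h.trans (hmax (hmem 1 hone le_rfl))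

/-- Gibbs' inequality, with its equality case. -/
theorem eq_of_sum_mul_log_le {ι : Type*} [Fintype ι] {p q : ι → ℝ} (hp : ∀ i, 0 < p i)
    (hq : ∀ i, 0 < q i) (hpq : ∑ i, p i = ∑ i, q i)
    (h : ∑ i, p i * Real.log (p i) ≤ ∑ i, p i * Real.log (q i)) (i : ι) : q i = p i := by
  -- The right sides sum to zero, so `h` forces equality in every term.
  have hle : ∀ i ∈ Finset.univ, p i * Real.log (q i) - p i * Real.log (p i) ≤ q i - p i :=
    fun i _ => by
      have h1 := mul_le_mul_of_nonneg_left
        (Real.log_le_sub_one_of_pos (div_pos (hq i) (hp i))) (hp i).le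
      rw [Real.log_div (hq i).ne' (hp i).ne', mul_sub, mul_sub, mul_one,
        mul_div_cancel₀ _ (hp i).ne'] at h1
      exact h1
  have heq := (Finset.sum_eq_sum_iff_of_le hle).1 (le_antisymm (Finset.sum_le_sum hle) (by
    rw [Finset.sum_sub_distrib, Finset.sum_sub_distrib, hpq]; linarith)) i (Finset.mem_univ i)
  by_contra hne
  have h1 := mul_lt_mul_of_pos_left (Real.log_lt_sub_one_of_pos (div_pos (hq i) (hp i))
    (fun h => hne ((div_eq_one_iff_eq (hp i).ne').1 h))) (hp i)
  rw [Real.log_div (hq i).ne' (hp i).ne', mul_sub, mul_sub, mul_one,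
    mul_div_cancel₀ _ (hp i).ne'] at h1
  exact h1.ne heq

/-- Maximizers of the weighted log-likelihoods converge, up to signs, to `Lstar` when the weights
converge to the law of the L-ensemble with kernel `Lstar`. -/
theorem tendsto_signDist_of_isMax {Lstar : Matrix (Fin N) (Fin N) ℝ} (hLstar : Lstar.PosDef)
    {p : ℕ → Finset (Fin N) → ℝ}
    (hp : ∀ J, Tendsto (fun n => p n J) atTop (𝓝 (lEnsembleProb Lstar J)))
    {Lhat : ℕ → Matrix (Fin N) (Fin N) ℝ}
    (hLhat : ∀ᶠ n in atTop, (Lhat n).PosDef ∧ ∀ M : Matrix (Fin N) (Fin N) ℝ, M.PosDef →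
      weightedLogLikelihood (p n) M ≤ weightedLogLikelihood (p n) (Lhat n)) :
    Tendsto (fun n => signDist (Lhat n) Lstar) atTop (𝓝 0) := by
  have hstar : Tendsto (fun n => weightedLogLikelihood (p n) Lstar) atTop
      (𝓝 (weightedLogLikelihood (lEnsembleProb Lstar) Lstar)) :=
    tendsto_finsetSum _ fun J _ => (hp J).mul_const _
  obtain ⟨J₀, hJ₀⟩ := Finite.exists_min (lEnsembleProb Lstar)
  -- The factor 1/2 here and the slack 1 in `C` let the limiting bounds hold for all large `n`.
  set η := lEnsembleProb Lstar J₀ / 2 with hη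
  have hη0 : 0 < η := half_pos (lEnsembleProb_pos hLstar J₀)
  set C := 1 - weightedLogLikelihood (lEnsembleProb Lstar) Lstar with hC
  have hδ := Real.exp_pos (-C / η)
  have hpη : ∀ᶠ n in atTop, ∀ J, η ≤ p n J := by
    rw [eventually_all]
    intro J
    refine (hp J).eventually_const_le ?_
    have := hJ₀ J
    linarith
  have hmem : ∀ᶠ n in atTop, Lhat n ∈ atomsGE N (Real.exp (-C / η)) := by
    filter_upwards [hpη, hLhat, hstar.eventually_const_le (u := -C) (by linarith)]
      with n h1 h2 h3
    exact mem_atomsGE_of_le_weightedLogLikelihood hη0 h1 h2.1 (h3.trans (h2.2 _ hLstar))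
  -- Along an ultrafilter compactness supplies a limit `L`; it may depend on the ultrafilter, but
  -- its distance to the orbit of `Lstar` is always zero.
  rw [tendsto_iff_ultrafilter]
  intro g hg
  obtain ⟨L, hL, hgL⟩ := (isCompact_atomsGE hδ).ultrafilter_le_nhds (g.map Lhat)
    (le_principal_iff.2 (hg hmem))
  have hgL' : Tendsto Lhat g (𝓝 L) := hgL
  have hgK : Tendsto Lhat g (𝓝[atomsGE N (Real.exp (-C / η))] L) :=
    tendsto_nhdsWithin_iff.2 ⟨hgL', hg hmem⟩
  have hLpd := posDef_of_mem_atomsGE hδ hL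
  have hlim : Tendsto (fun n => weightedLogLikelihood (p n) (Lhat n)) g
      (𝓝 (weightedLogLikelihood (lEnsembleProb Lstar) L)) :=
    tendsto_finsetSum _ fun J _ => ((hp J).mono_left hg).mul
      ((continuousOn_log_lEnsembleProb hδ J L hL).tendsto.comp hgK)
  have hle : weightedLogLikelihood (lEnsembleProb Lstar) Lstar ≤
      weightedLogLikelihood (lEnsembleProb Lstar) L :=
    le_of_tendsto_of_tendsto (hstar.mono_left hg) hlim
      (hg (hLhat.mono fun n hn => hn.2 _ hLstar))
  have hprob := eq_of_sum_mul_log_le (lEnsembleProb_pos hLstar) (lEnsembleProb_pos hLpd)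
    (by rw [sum_lEnsembleProb hLstar.posSemidef, sum_lEnsembleProb hLpd.posSemidef]) hle
  rw [← signDist_eq_zero_of_lEnsembleProb_eq hLpd hLstar hprob]
  exact ((continuous_signDist Lstar).tendsto L).comp hgL'

/-! ### Empirical frequencies and the law of large numbers -/

/-- The relative frequency of `J` in the sample `z`. -/
noncomputable def frequency {n : ℕ} (z : Fin n → Finset (Fin N)) (J : Finset (Fin N)) : ℝ :=
  (∑ i, ({J} : Set (Finset (Fin N))).indicator 1 (z i)) / n

/-- Grouping the sample by value moves all randomness into the weights, so the rest of the argument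
is deterministic. -/
theorem logLikelihood_eq_weightedLogLikelihood {n : ℕ} (z : Fin n → Finset (Fin N))
    (L : Matrix (Fin N) (Fin N) ℝ) :
    logLikelihood z L = weightedLogLikelihood (frequency z) L := by
  simp only [logLikelihood, weightedLogLikelihood, frequency, div_mul_eq_mul_div, Finset.sum_mul]
  rw [← Finset.sum_div, Finset.sum_comm, one_mul]
  congr 1
  refine Finset.sum_congr rfl fun i _ => ?_
  rw [Finset.sum_eq_single (z i)]
  · simp
  · intro J _ hJ
    simp [hJ.symm]
  · simp

theorem isMLE_iff {n : ℕ} {z : Fin n → Finset (Fin N)} {L : Matrix (Fin N) (Fin N) ℝ} :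
    IsMLE z L ↔ L.PosDef ∧ ∀ M : Matrix (Fin N) (Fin N) ℝ, M.PosDef →
      weightedLogLikelihood (frequency z) M ≤ weightedLogLikelihood (frequency z) L := by
  simp only [IsMLE, logLikelihood_eq_weightedLogLikelihood]

/-- Strong law of large numbers for the relative frequencies of an i.i.d. sample of subsets. -/
theorem ae_tendsto_frequency {Ω : Type*} [MeasurableSpace Ω] (P : Measure Ω)
    [IsProbabilityMeasure P] (Z : ℕ → Ω → Finset (Fin N)) (hmeas : ∀ i, Measurable (Z i))
    (hindep : iIndepFun Z P) {q : Finset (Fin N) → ℝ}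
    (hlaw : ∀ i J, P.real (Z i ⁻¹' {J}) = q J) :
    ∀ᵐ ω ∂P, ∀ J, Tendsto (fun n => frequency (fun i : Fin n => Z i ω) J) atTop (𝓝 (q J)) := by
  rw [ae_all_iff]
  intro J
  set φ : Finset (Fin N) → ℝ := ({J} : Set (Finset (Fin N))).indicator 1
  have hφm : Measurable φ := measurable_of_finite φ
  have hident : ∀ i, IdentDistrib (Z i) (Z 0) P P := fun i => by
    refine ⟨(hmeas i).aemeasurable, (hmeas 0).aemeasurable, ?_⟩
    refine Measure.ext_of_singleton fun A => ?_
    rw [Measure.map_apply (hmeas i) (measurableSet_singleton A),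
      Measure.map_apply (hmeas 0) (measurableSet_singleton A),
      ← ENNReal.toReal_eq_toReal_iff' (measure_ne_top _ _) (measure_ne_top _ _)]
    exact (hlaw i A).trans (hlaw 0 A).symm
  have hcomp : φ ∘ Z 0 = (Z 0 ⁻¹' {J}).indicator 1 := by
    ext ω
    rfl
  have hset : MeasurableSet (Z 0 ⁻¹' {J}) := hmeas 0 (measurableSet_singleton J)
  have h := strong_law_ae_real (μ := P) (fun i => φ ∘ Z i)
    (by
      simp only [hcomp]
      exact (integrable_const (1 : ℝ)).indicator hset)
    (fun i j hij => (hindep.indepFun hij).comp hφm hφm)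
    (fun i => (hident i).comp hφm)
  filter_upwards [h] with ω hω
  have hint : ∫ x, (φ ∘ Z 0) x ∂P = q J := by
    rw [hcomp, integral_indicator_one hset, hlaw]
  rw [hint] at hω
  refine hω.congr fun n => ?_
  rw [frequency, Fin.sum_univ_eq_sum_range (fun i => φ (Z i ω)) n]
  rfl

end DPP

theorem theorem3p3 {N : ℕ} (Lstar : Matrix (Fin N) (Fin N) ℝ) (hLstar : Lstar.PosDef)
    {Ω : Type*} [MeasurableSpace Ω] (P : Measure Ω) [IsProbabilityMeasure P]
    (Z : ℕ → Ω → Finset (Fin N)) (hZ_meas : ∀ i, Measurable (Z i))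
    (hZ_indep : iIndepFun Z P)
    (hZ_law : ∀ i J, P.real (Z i ⁻¹' {J}) = DPP.lEnsembleProb Lstar J)
    (Lhat : ℕ → Ω → Matrix (Fin N) (Fin N) ℝ)
    (hLhat : ∀ n, 1 ≤ n → ∀ᵐ ω ∂P,
      (∃ L, DPP.IsMLE (fun i : Fin n => Z i ω) L) →
        DPP.IsMLE (fun i : Fin n => Z i ω) (Lhat n ω)) :
    (∀ᵐ ω ∂P, ∀ᶠ n in atTop, ∃ L, DPP.IsMLE (fun i : Fin n => Z i ω) L) ∧
      ∀ᵐ ω ∂P, Tendsto (fun n => DPP.signDist (Lhat n ω) Lstar) atTop (𝓝 0) := by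
  have hexists : ∀ᵐ ω ∂P, ∀ᶠ n in atTop, ∃ L, DPP.IsMLE (fun i : Fin n => Z i ω) L := by
    filter_upwards [DPP.ae_tendsto_frequency P Z hZ_meas hZ_indep hZ_law] with ω hω
    -- Every atom of the true law is positive, so eventually each subset has been observed.
    have hpos : ∀ᶠ n in atTop, ∀ J, 0 < DPP.frequency (fun i : Fin n => Z i ω) J :=
      eventually_all.2 fun J =>
        (hω J).eventually (lt_mem_nhds (DPP.lEnsembleProb_pos hLstar J))
    filter_upwards [hpos] with n hn
    obtain ⟨L, hL⟩ := DPP.exists_isMax_weightedLogLikelihood hn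
    exact ⟨L, DPP.isMLE_iff.2 hL⟩
  refine ⟨hexists, ?_⟩
  filter_upwards [DPP.ae_tendsto_frequency P Z hZ_meas hZ_indep hZ_law, hexists,
    ae_all_iff.2 fun n => ae_all_iff.2 fun h : 1 ≤ n => hLhat n h] with ω hω hex hhat
  refine DPP.tendsto_signDist_of_isMax hLstar hω ?_
  filter_upwards [hex, eventually_ge_atTop 1] with n hn h1
  exact DPP.isMLE_iff.1 (hhat n h1 hn)
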